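/- Call a finite set $\mathcal F$ of finite sets (edges) a hypergraph. It is $k$-uniform if each of its edges has exactly $k$ elements, and $[a,b]$-almost intersecting if every $A\in\mathcal F$ satisfies $a\le|\{B\in\mathcal F: A\cap B=\emptyset\}|\le b$; it is $s$-almost intersecting if it is $[s,s]$-almost intersecting. Given disjoint finite sets $A,B$ with $|A|=2k-2$ and $|B|\ge s+1$, and a map $f:\binom{A}{k-1}\to\binom{B}{s+1}$ with $f(S)=f(A\setminus S)$ for every $S\in\binom{A}{k-1}$, put $$\mathcal M_f=\Big\{S\cup\{x\}: S\in\tbinom{A}{k-1},\ x\in f(S)\Big\}.$$ **Theorem.** Fix an integer $k>2$. There exist constants $R=R(k)$ and $s_0=s_0(k)$ such that for every integer $s>s_0$ the following hold. 1. Every $k$-uniform $[R,s]$-almost intersecting hypergraph has at most $(s+1)\binom{2k-2}{k-1}$ edges. 2. The $k$-uniform $[R,s]$-almost intersecting hypergraphs with exactly $(s+1)\binom{2k-2}{k-1}$ edges are exactly the hypergraphs $\mathcal M_f$, for $A,B,f$ as above. 3. Every such $\mathcal M_f$ is $s$-almost intersecting. -/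

import Mathlib

/-- A finite hypergraph `F` is `[a,b]`-almost intersecting if every edge of `F` is disjoint from
at least `a` and at most `b` edges of `F`. -/
def IsAlmostIntersecting {V : Type*} [DecidableEq V] (a b : ℕ) (F : Finset (Finset V)) : Prop :=
  ∀ A ∈ F, a ≤ (F.filter (fun B => A ∩ B = ∅)).card ∧ (F.filter (fun B => A ∩ B = ∅)).card ≤ b

/-- The hypergraph `M_f = {S ∪ {x} : S a (k-1)-subset of A, x ∈ f S}`. -/
def doubleStarFamily {V : Type*} [DecidableEq V] (k : ℕ) (A : Finset V)
    (f : Finset V → Finset V) : Finset (Finset V) :=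
  (A.powersetCard (k - 1)).biUnion (fun S => (f S).image (fun x => S ∪ {x}))

/-- `F` has the form `M_f`, where `A` and `B` are disjoint sets with `|A| = 2k-2` and
`|B| ≥ s+1`, and `f` maps the `(k-1)`-subsets of `A` to `(s+1)`-subsets of `B` so that
`f S = f (A \ S)`. (The values of `f` on other sets are irrelevant.) -/
def IsDoubleStarFamily {V : Type*} [DecidableEq V] (k s : ℕ) (F : Finset (Finset V)) : Prop :=
  ∃ (A B : Finset V) (f : Finset V → Finset V),
    Disjoint A B ∧ A.card = 2 * k - 2 ∧ s + 1 ≤ B.card ∧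
    (∀ S ∈ A.powersetCard (k - 1), f S ∈ B.powersetCard (s + 1) ∧ f S = f (A \ S)) ∧
    F = doubleStarFamily k A f

/-! Let `N = (2k-2).choose (k-1)` and let `F` have at least `(s+1)N` edges. The aim is to force `F`
into the form `M_f`; since `M_f` has exactly `(s+1)N` edges, this gives the bound and the extremal
families together.

Every edge misses more than `(pk)^k` edges, hence misses the kernel `T` of a sunflower with `p`
petals, `|T| < k`. An edge missing `T` meets at most `k` petals, so double counting against the
petals shows that at most `(1 + 1/(8N))s` edges miss `T`. A minimal set of kernels such that every
edge misses one is half of a set-pair system, so Bollobás's inequality bounds its size, and its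
union `U`, in terms of `k` alone. Boundedly many edges lie inside `U`. The others have traces on `U`
of size at most `k-1`, and a minimal set of kernels serving these has at most `N` members, again by
Bollobás. Fewer than `N` would cover too few edges, so there are exactly `N`, and uniqueness in
Bollobás's theorem makes them all the `(k-1)`-subsets of a `(2k-2)`-set `W`.

Each `(k-1)`-subset of `W` is then the trace of nearly `s` edges or more. An edge with a trace
smaller than `k-1` would miss almost all edges of two such classes, more than `s` in total; so every
edge is a `(k-1)`-subset of `W` plus one outside point. Comparing complementary traces bounds each
class by `s+1`, and the edge count forces equality. -/

/-! ### Bollobás's set-pair inequality and its extremal systems -/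

/-- A cross-intersecting set-pair system: `T i` and `X j` are disjoint exactly when `i = j`. -/
structure IsSetPairSystem {ι α : Type*} (I : Finset ι) (T X : ι → Finset α) : Prop where
  disjoint : ∀ i ∈ I, Disjoint (T i) (X i)
  eq_of_disjoint : ∀ i ∈ I, ∀ j ∈ I, Disjoint (T i) (X j) → i = j

theorem inv_choose_succ_mul (a b : ℕ) :
    ((b + 1 : ℕ) : ℚ) * ((a + b).choose a : ℚ)⁻¹ =
      ((a + (b + 1) : ℕ) : ℚ) * ((a + (b + 1)).choose a : ℚ)⁻¹ := by
  have h1 : ((a + b).choose a : ℚ) ≠ 0 := by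
    exact_mod_cast (Nat.choose_pos (Nat.le_add_right a b)).ne'
  have h2 : ((a + (b + 1)).choose a : ℚ) ≠ 0 := by
    exact_mod_cast (Nat.choose_pos (Nat.le_add_right a (b + 1))).ne'
  have h := Nat.choose_mul_succ_eq (a + b) a
  rw [show a + b + 1 - a = b + 1 by omega, show a + b + 1 = a + (b + 1) by ring] at h
  have h' : ((a + b).choose a : ℚ) * ((a + (b + 1) : ℕ) : ℚ) =
      ((a + (b + 1)).choose a : ℚ) * ((b + 1 : ℕ) : ℚ) := by exact_mod_cast h
  field_simp
  linarith

/-- In a random ordering of `Y`, all of `X` precedes all of `T` with probability `1 /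
(|T|+|X|).choose |T|`. The summand at `y` is this probability conditioned on `y` coming first; for
`y ∈ T` it is zero, as `X` is nonempty. -/
theorem sum_inv_choose_erase {α : Type*} [DecidableEq α] {Y T X : Finset α} (hT : T ⊆ Y)
    (hX : X ⊆ Y) (hd : Disjoint T X) (hne : X.Nonempty) :
    ∑ y ∈ Y \ T, ((T.card + (X.erase y).card).choose T.card : ℚ)⁻¹ =
      Y.card * ((T.card + X.card).choose T.card : ℚ)⁻¹ := by
  have hXs : X ⊆ Y \ T := Finset.subset_sdiff.2 ⟨hX, hd.symm⟩
  rw [← Finset.sum_sdiff hXs]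
  obtain ⟨b, hb⟩ : ∃ b, X.card = b + 1 := ⟨X.card - 1, by have := hne.card_pos; omega⟩
  have e1 : ∑ y ∈ (Y \ T) \ X, ((T.card + (X.erase y).card).choose T.card : ℚ)⁻¹ =
      ((Y \ T) \ X).card * ((T.card + X.card).choose T.card : ℚ)⁻¹ := by
    rw [← nsmul_eq_mul]
    refine Finset.sum_eq_card_nsmul fun y hy => ?_
    rw [Finset.erase_eq_of_notMem (Finset.mem_sdiff.1 hy).2]
  have e2 : ∑ y ∈ X, ((T.card + (X.erase y).card).choose T.card : ℚ)⁻¹ =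
      X.card * ((T.card + b).choose T.card : ℚ)⁻¹ := by
    rw [← nsmul_eq_mul]
    refine Finset.sum_eq_card_nsmul fun y hy => ?_
    rw [Finset.card_erase_of_mem hy, hb, Nat.add_sub_cancel]
  have hc : ((Y \ T) \ X).card + (T.card + X.card) = Y.card := by
    have h1 := Finset.card_sdiff_add_card_eq_card hXs
    have h2 := Finset.card_sdiff_add_card_eq_card hT
    omega
  rw [e1, e2, hb, inv_choose_succ_mul, ← hc, hb]
  push_cast
  ring

/-- Bollobás's set-pair inequality. In the case of equality every ordering of the ground set
separates one of the pairs. -/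
theorem IsSetPairSystem.sum_inv_choose_le_one {ι α : Type*} [DecidableEq α] (Y : Finset α) :
    ∀ (I : Finset ι) (T X : ι → Finset α), IsSetPairSystem I T X →
      (∀ i ∈ I, T i ⊆ Y) → (∀ i ∈ I, X i ⊆ Y) →
      ∑ i ∈ I, (((T i).card + (X i).card).choose (T i).card : ℚ)⁻¹ ≤ 1 ∧
      (∑ i ∈ I, (((T i).card + (X i).card).choose (T i).card : ℚ)⁻¹ = 1 →
        ∀ l : List α, l.Nodup → l.toFinset = Y →
          ∃ i ∈ I, ∃ l₁ l₂, l = l₁ ++ l₂ ∧ X i ⊆ l₁.toFinset ∧ T i ⊆ l₂.toFinset) := by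
  classical
  induction hn : Y.card generalizing Y with
  | zero =>
    intro I T X h hT hX
    obtain rfl := Finset.card_eq_zero.1 hn
    have hT' : ∀ i ∈ I, T i = ∅ := fun i hi => Finset.subset_empty.1 (hT i hi)
    have hX' : ∀ i ∈ I, X i = ∅ := fun i hi => Finset.subset_empty.1 (hX i hi)
    have hI : I.card ≤ 1 := Finset.card_le_one.2 fun i hi j hj =>
      h.eq_of_disjoint i hi j hj (by rw [hT' i hi]; exact Finset.disjoint_empty_left _)
    have hs : ∑ i ∈ I, (((T i).card + (X i).card).choose (T i).card : ℚ)⁻¹ = I.card := by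
      rw [Finset.cast_card]
      exact Finset.sum_congr rfl fun i hi => by simp [hT' i hi]
    rw [hs]
    refine ⟨by exact_mod_cast hI, fun h1 l _ _ => ?_⟩
    have : I.card = 1 := by exact_mod_cast h1
    obtain ⟨i, hi⟩ := Finset.card_pos.1 (by omega : 0 < I.card)
    exact ⟨i, hi, [], l, rfl, by simp [hX' i hi], by simp [hT' i hi]⟩
  | succ n ih =>
    intro I T X h hT hX
    -- Condition on the first element `y` of an ordering: the pairs with `y ∉ T i` survive, with `y`
    -- deleted from `X i`. Averaging over `y` gives back the original sum if no `X i` is empty; an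
    -- empty `X i` is disjoint from every `T j`, so `i` is then the only index.
    by_cases hne : ∀ i ∈ I, (X i).Nonempty
    · have key : ∀ y ∈ Y, IsSetPairSystem (I.filter fun i => y ∉ T i) T (fun i => (X i).erase y) ∧
          (∀ i ∈ I.filter fun i => y ∉ T i, T i ⊆ Y.erase y) ∧
          (∀ i ∈ I.filter fun i => y ∉ T i, (X i).erase y ⊆ Y.erase y) := by
        intro y hy
        refine ⟨⟨fun i hi => ?_, fun i hi j hj hd => ?_⟩, fun i hi => ?_, fun i hi => ?_⟩
        · exact (h.disjoint i (Finset.mem_filter.1 hi).1).mono_right (Finset.erase_subset _ _)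
        · refine h.eq_of_disjoint i (Finset.mem_filter.1 hi).1 j (Finset.mem_filter.1 hj).1 ?_
          rw [Finset.disjoint_left] at hd ⊢
          intro a ha ha'
          refine hd ha (Finset.mem_erase.2 ⟨?_, ha'⟩)
          rintro rfl
          exact (Finset.mem_filter.1 hi).2 ha
        · exact Finset.subset_erase.2 ⟨hT i (Finset.mem_filter.1 hi).1, (Finset.mem_filter.1 hi).2⟩
        · exact Finset.erase_subset_erase _ (hX i (Finset.mem_filter.1 hi).1)
      have IH := fun y (hy : y ∈ Y) => ih (Y.erase y) (by rw [Finset.card_erase_of_mem hy]; omega)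
        _ _ _ (key y hy).1 (key y hy).2.1 (key y hy).2.2
      have hsum : ∑ y ∈ Y, ∑ i ∈ I.filter (fun i => y ∉ T i),
          (((T i).card + ((X i).erase y).card).choose (T i).card : ℚ)⁻¹ =
          Y.card * ∑ i ∈ I, (((T i).card + (X i).card).choose (T i).card : ℚ)⁻¹ := by
        rw [Finset.mul_sum]
        simp_rw [Finset.sum_filter]
        rw [Finset.sum_comm]
        refine Finset.sum_congr rfl fun i hi => ?_
        rw [← Finset.sum_filter, ← Finset.sdiff_eq_filter]
        exact sum_inv_choose_erase (hT i hi) (hX i hi) (h.disjoint i hi) (hne i hi)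
      have hle := Finset.sum_le_sum fun y hy => (IH y hy).1
      have hYpos : (0 : ℚ) < Y.card := by rw [hn]; positivity
      simp only [Finset.sum_const, nsmul_eq_mul] at hle
      rw [hsum] at hle
      refine ⟨le_of_mul_le_mul_left hle hYpos, fun h1 l hl hlY => ?_⟩
      rcases l with _ | ⟨y, l⟩
      · rw [← hlY] at hn; simp at hn
      have hy : y ∈ Y := by rw [← hlY]; simp
      have heq := (Finset.sum_eq_sum_iff_of_le fun y hy => (IH y hy).1).1
        (by rw [hsum, h1]; simp) y hy
      obtain ⟨i, hi, l₁, l₂, rfl, h2, h3⟩ := (IH y hy).2 heq l hl.of_cons (by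
        rw [← hlY, List.toFinset_cons, Finset.erase_insert]
        simpa using (List.nodup_cons.1 hl).1)
      refine ⟨i, (Finset.mem_filter.1 hi).1, y :: l₁, l₂, rfl, ?_, h3⟩
      rw [List.toFinset_cons]
      exact (Finset.subset_insert_iff).2 h2
    · push Not at hne
      obtain ⟨i, hi, hXi⟩ := hne
      have hI : I = {i} := Finset.eq_singleton_iff_unique_mem.2 ⟨hi, fun j hj =>
        h.eq_of_disjoint j hj i hi (by rw [hXi]; exact Finset.disjoint_empty_right _)⟩
      refine ⟨by simp [hI, hXi], fun _ l _ hl => ⟨i, hi, [], l, rfl, by simp [hXi], ?_⟩⟩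
      rw [hl]
      exact hT i hi

theorem choose_add_lt_choose_two_mul {a b n : ℕ} (ha : a ≤ n) (hb : b ≤ n) (hn : 0 < n)
    (hab : ¬(a = n ∧ b = n)) : (a + b).choose a < (2 * n).choose n := by
  have key : ∀ c ≤ n, (c + (n - 1)).choose c < (2 * n).choose n := by
    intro c hc
    obtain ⟨m, rfl⟩ : ∃ m, n = m + 1 := ⟨n - 1, by omega⟩
    calc (c + m).choose c = (c + m).choose m := Nat.choose_symm_add
      _ ≤ (m + 1 + m).choose m := Nat.choose_le_choose _ (by omega)
      _ < (m + 1 + m).choose m + (m + 1 + m).choose (m + 1) :=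
        Nat.lt_add_of_pos_right (Nat.choose_pos (by omega))
      _ = (2 * (m + 1)).choose (m + 1) := by
        rw [show 2 * (m + 1) = (m + 1 + m) + 1 by ring, Nat.choose_succ_succ]
  by_cases h : b = n
  · have : a ≤ n - 1 := by omega
    calc (a + b).choose a = (b + a).choose b := by rw [Nat.choose_symm_add, add_comm]
      _ ≤ (b + (n - 1)).choose b := Nat.choose_le_choose _ (by omega)
      _ < _ := key b hb
  · exact (Nat.choose_le_choose _ (by omega)).trans_lt (key a ha)

theorem choose_add_le_choose_two_mul {a b n : ℕ} (ha : a ≤ n) (hb : b ≤ n) :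
    (a + b).choose a ≤ (2 * n).choose n := by
  rcases Nat.eq_zero_or_pos n with rfl | hn
  · obtain rfl : a = 0 := by omega
    simp
  · by_cases hab : a = n ∧ b = n
    · rw [hab.1, hab.2, two_mul]
    · exact (choose_add_lt_choose_two_mul ha hb hn hab).le

theorem IsSetPairSystem.card_le {ι α : Type*} [DecidableEq α] {I : Finset ι} {T X : ι → Finset α}
    (h : IsSetPairSystem I T X) {n : ℕ} (hT : ∀ i ∈ I, (T i).card ≤ n)
    (hX : ∀ i ∈ I, (X i).card ≤ n) : I.card ≤ (2 * n).choose n := by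
  have h1 := (h.sum_inv_choose_le_one (I.biUnion T ∪ I.biUnion X) I T X
    (fun i hi => (Finset.subset_biUnion_of_mem T hi).trans Finset.subset_union_left)
    (fun i hi => (Finset.subset_biUnion_of_mem X hi).trans Finset.subset_union_right)).1
  have hpos : (0 : ℚ) < (2 * n).choose n := by
    exact_mod_cast Nat.choose_pos (by omega)
  have h2 := (Finset.card_nsmul_le_sum I _ ((2 * n).choose n : ℚ)⁻¹ fun i hi => by
    have : (0 : ℚ) < ((T i).card + (X i).card).choose (T i).card := by
      exact_mod_cast Nat.choose_pos (by omega)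
    refine inv_anti₀ this ?_
    exact_mod_cast choose_add_le_choose_two_mul (hT i hi) (hX i hi)).trans h1
  rw [nsmul_eq_mul, ← div_eq_mul_inv, div_le_one hpos] at h2
  exact_mod_cast h2

/-- There are `(2n).choose n` terms, each at least the reciprocal of that number, with sum at most
1. So every term is minimal, and this happens only when both sets have size `n`. -/
theorem IsSetPairSystem.sum_eq_one {ι α : Type*} [DecidableEq α] {I : Finset ι}
    {T X : ι → Finset α} (h : IsSetPairSystem I T X) {n : ℕ} (hn : 0 < n)
    (hT : ∀ i ∈ I, (T i).card ≤ n)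
    (hX : ∀ i ∈ I, (X i).card ≤ n) (hI : I.card = (2 * n).choose n) :
    (∀ i ∈ I, (T i).card = n ∧ (X i).card = n) ∧
      ∑ i ∈ I, (((T i).card + (X i).card).choose (T i).card : ℚ)⁻¹ = 1 := by
  have h1 := (h.sum_inv_choose_le_one (I.biUnion T ∪ I.biUnion X) I T X
    (fun i hi => (Finset.subset_biUnion_of_mem T hi).trans Finset.subset_union_left)
    (fun i hi => (Finset.subset_biUnion_of_mem X hi).trans Finset.subset_union_right)).1
  have hpos : (0 : ℚ) < (2 * n).choose n := by
    exact_mod_cast Nat.choose_pos (by omega)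
  have hle : ∀ i ∈ I, ((2 * n).choose n : ℚ)⁻¹ ≤
      (((T i).card + (X i).card).choose (T i).card : ℚ)⁻¹ := fun i hi => by
    have : (0 : ℚ) < ((T i).card + (X i).card).choose (T i).card := by
      exact_mod_cast Nat.choose_pos (by omega)
    refine inv_anti₀ this ?_
    exact_mod_cast choose_add_le_choose_two_mul (hT i hi) (hX i hi)
  have hc : ∑ _i ∈ I, ((2 * n).choose n : ℚ)⁻¹ = 1 := by
    rw [Finset.sum_const, hI, nsmul_eq_mul, mul_inv_cancel₀ hpos.ne']
  have hs : ∑ i ∈ I, (((T i).card + (X i).card).choose (T i).card : ℚ)⁻¹ = 1 :=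
    le_antisymm h1 (hc ▸ Finset.sum_le_sum hle)
  refine ⟨fun i hi => ?_, hs⟩
  have heq := (Finset.sum_eq_sum_iff_of_le hle).1 (hc.trans hs.symm) i hi
  by_contra hcon
  have hlt := choose_add_lt_choose_two_mul (hT i hi) (hX i hi) hn hcon
  rw [inv_inj] at heq
  exact hlt.ne' (by exact_mod_cast heq)

/-- Take the ordering `P, t, x, Q`. The three alternatives record whether the separating cut falls
before `t`, between `t` and `x`, or after `x`. -/
theorem exists_separated_of_ordering {ι α : Type*} [DecidableEq α] {Y P Q : Finset α}
    {I : Finset ι} {T X : ι → Finset α} {t x : α}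
    (hsep : ∀ l : List α, l.Nodup → l.toFinset = Y →
      ∃ i ∈ I, ∃ l₁ l₂, l = l₁ ++ l₂ ∧ X i ⊆ l₁.toFinset ∧ T i ⊆ l₂.toFinset)
    (hPQ : Disjoint P Q) (htx : t ≠ x) (htP : t ∉ P) (htQ : t ∉ Q) (hxP : x ∉ P) (hxQ : x ∉ Q)
    (hY : P ∪ insert t (insert x Q) = Y) :
    ∃ j ∈ I, X j ⊆ P ∨ (X j ⊆ insert t P ∧ T j ⊆ insert x Q) ∨ T j ⊆ Q := by
  obtain ⟨j, hj, l₁, l₂, hl, h1, h2⟩ := hsep (P.toList ++ t :: x :: Q.toList) (by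
      rw [List.nodup_append]
      refine ⟨P.nodup_toList, ?_, ?_⟩
      · simp [htx, htQ, hxQ, Q.nodup_toList]
      · intro a ha b hb
        rw [Finset.mem_toList] at ha
        rintro rfl
        simp only [List.mem_cons, Finset.mem_toList] at hb
        rcases hb with rfl | rfl | hb
        · exact htP ha
        · exact hxP ha
        · exact Finset.disjoint_left.1 hPQ ha hb)
    (by rw [← hY]; simp)
  refine ⟨j, hj, ?_⟩
  rcases List.append_eq_append_iff.1 hl with ⟨a, rfl, ha⟩ | ⟨c, hc, rfl⟩
  · rcases a with _ | ⟨t', a⟩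
    · left; simpa using h1
    · rw [List.cons_append, List.cons.injEq] at ha
      obtain ⟨rfl, ha⟩ := ha
      right
      rcases a with _ | ⟨x', a⟩
      · left
        rw [List.nil_append] at ha
        subst ha
        refine ⟨fun z hz => ?_, fun z hz => ?_⟩
        · have := h1 hz
          simp only [List.toFinset_append, Finset.mem_union, List.mem_toFinset, Finset.mem_toList,
            List.mem_cons, List.not_mem_nil, or_false] at this
          rw [Finset.mem_insert]; tauto
        · simpa using h2 hz
      · right
        rw [List.cons_append, List.cons.injEq] at ha
        intro z hz
        have := h2 hz
        rw [← Finset.mem_toList, ha.2]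
        exact List.mem_append_right _ (List.mem_toFinset.1 this)
  · left
    intro z hz
    rw [← Finset.mem_toList, hc]
    exact List.mem_append_left _ (List.mem_toFinset.1 (h1 hz))

theorem erase_union_insert_sdiff_right {α : Type*} [DecidableEq α] {Y A B : Finset α} {t x : α}
    (ht : t ∈ A) (hx : x ∈ B) (hA : A ⊆ Y) (hB : B ⊆ Y) :
    B.erase x ∪ insert t (insert x (A.erase t ∪ (Y \ (A ∪ B)))) = Y := by
  grind

theorem erase_union_insert_sdiff_left {α : Type*} [DecidableEq α] {Y A B : Finset α} {t x : α}
    (ht : t ∈ A) (hx : x ∈ B) (hA : A ⊆ Y) (hB : B ⊆ Y) :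
    (B.erase x ∪ (Y \ (A ∪ B))) ∪ insert t (insert x (A.erase t)) = Y := by
  grind

/-- Order `Y` as `X i \ x, t, x, T i \ t`, with the elements outside `T i ∪ X i` put once at the end
and once at the start. Sizes and the uniqueness of disjoint pairs force the cut between `t` and `x`.
The first ordering determines some `X j`, the second some `T j'`; these are disjoint, so `j' = j`.
-/
theorem IsSetPairSystem.exists_swap {ι α : Type*} [DecidableEq α] {Y : Finset α}
    {I : Finset ι} {T X : ι → Finset α} (h : IsSetPairSystem I T X) {n : ℕ} (hn : 0 < n)
    (hc : ∀ i ∈ I, (T i).card = n ∧ (X i).card = n)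
    (hTY : ∀ i ∈ I, T i ⊆ Y) (hXY : ∀ i ∈ I, X i ⊆ Y)
    (hsep : ∀ l : List α, l.Nodup → l.toFinset = Y →
      ∃ i ∈ I, ∃ l₁ l₂, l = l₁ ++ l₂ ∧ X i ⊆ l₁.toFinset ∧ T i ⊆ l₂.toFinset)
    {i : ι} (hi : i ∈ I) {t x : α} (ht : t ∈ T i) (hx : x ∈ X i) :
    ∃ j ∈ I, T j = insert x ((T i).erase t) ∧ X j = insert t ((X i).erase x) := by
  have hd := h.disjoint i hi
  have htX : t ∉ X i := Finset.disjoint_left.1 hd ht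
  have hxT : x ∉ T i := Finset.disjoint_right.1 hd hx
  have htx : t ≠ x := by rintro rfl; exact htX hx
  have hTX : ∀ z, z ∈ T i → z ∉ X i := fun z hz => Finset.disjoint_left.1 hd hz
  have hcT : ((T i).erase t).card < n := by
    rw [Finset.card_erase_of_mem ht, (hc i hi).1]; omega
  have hcX : ((X i).erase x).card < n := by
    rw [Finset.card_erase_of_mem hx, (hc i hi).2]; omega
  have hcT' : (insert x ((T i).erase t)).card = n := by
    rw [Finset.card_insert_of_notMem (fun h => hxT (Finset.mem_of_mem_erase h)),
      Finset.card_erase_of_mem ht, (hc i hi).1]; omega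
  have hcX' : (insert t ((X i).erase x)).card = n := by
    rw [Finset.card_insert_of_notMem (fun h => htX (Finset.mem_of_mem_erase h)),
      Finset.card_erase_of_mem hx, (hc i hi).2]; omega
  obtain ⟨j, hj, hj'⟩ := exists_separated_of_ordering (P := (X i).erase x)
    (Q := (T i).erase t ∪ (Y \ (T i ∪ X i))) (t := t) (x := x) hsep
    (by rw [Finset.disjoint_left]; intro z; have := hTX z; simp; tauto) htx
    (by simp [htX]) (by simp [ht]) (by simp) (by simp [hx, hxT])
    (erase_union_insert_sdiff_right ht hx (hTY i hi) (hXY i hi))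
  obtain ⟨j', hj₂, hj₂'⟩ := exists_separated_of_ordering
    (P := (X i).erase x ∪ (Y \ (T i ∪ X i)))
    (Q := (T i).erase t) (t := t) (x := x) hsep
    (by rw [Finset.disjoint_left]; intro z; have := hTX z; simp; tauto) htx
    (by simp [htX, ht]) (by simp) (by simp [hx]) (by simp [hxT])
    (erase_union_insert_sdiff_left ht hx (hTY i hi) (hXY i hi))
  have hXj : X j = insert t ((X i).erase x) := by
    rcases hj' with h1 | h1 | h1
    · have := Finset.card_le_card h1
      have := (hc j hj).2
      omega
    · exact Finset.eq_of_subset_of_card_le h1.1 (by rw [hcX', (hc j hj).2])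
    · obtain rfl : j = i := h.eq_of_disjoint j hj i hi (by
        rw [Finset.disjoint_left]
        intro z hz hz'
        have h2 := h1 hz
        have := hTX z
        simp only [Finset.mem_union, Finset.mem_erase, Finset.mem_sdiff] at h2
        tauto)
      have := h1 ht
      simp [ht] at this
  have hTj : T j' = insert x ((T i).erase t) := by
    rcases hj₂' with h1 | h1 | h1
    · obtain rfl : i = j' := h.eq_of_disjoint i hi j' hj₂ (by
        rw [Finset.disjoint_left]
        intro z hz hz'
        have h2 := h1 hz'
        have := hTX z
        simp only [Finset.mem_union, Finset.mem_erase, Finset.mem_sdiff] at h2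
        tauto)
      have := h1 hx
      simp [hx] at this
    · exact Finset.eq_of_subset_of_card_le h1.2 (by rw [hcT', (hc j' hj₂).1])
    · have := Finset.card_le_card h1
      have := (hc j' hj₂).1
      omega
  obtain rfl : j' = j := h.eq_of_disjoint j' hj₂ j hj (by
    rw [hTj, hXj, Finset.disjoint_left]
    intro z
    have := hTX z
    have h3 : z = t → z ∈ T i := by rintro rfl; exact ht
    have h4 : z = x → z ∈ X i := by rintro rfl; exact hx
    simp only [Finset.mem_insert, Finset.mem_erase]
    tauto)
  exact ⟨j', hj, hTj, hXj⟩

/-- Uniqueness in Bollobás's theorem for pairs of sets of size at most `n`. -/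
theorem IsSetPairSystem.exists_image_eq_powersetCard {ι α : Type*} [DecidableEq α]
    {I : Finset ι} {T X : ι → Finset α} (h : IsSetPairSystem I T X) {n : ℕ} (hn : 0 < n)
    (hT : ∀ i ∈ I, (T i).card ≤ n) (hX : ∀ i ∈ I, (X i).card ≤ n)
    (hI : I.card = (2 * n).choose n) :
    ∃ W : Finset α, W.card = 2 * n ∧ I.image T = W.powersetCard n := by
  obtain ⟨hc, hs⟩ := h.sum_eq_one hn hT hX hI
  have hTY : ∀ i ∈ I, T i ⊆ I.biUnion T ∪ I.biUnion X := fun i hi =>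
    (Finset.subset_biUnion_of_mem T hi).trans Finset.subset_union_left
  have hXY : ∀ i ∈ I, X i ⊆ I.biUnion T ∪ I.biUnion X := fun i hi =>
    (Finset.subset_biUnion_of_mem X hi).trans Finset.subset_union_right
  have hsep := (h.sum_inv_choose_le_one _ I T X hTY hXY).2 hs
  obtain ⟨i₀, hi₀⟩ := Finset.card_pos.1 (hI ▸ Nat.choose_pos (by omega) : 0 < I.card)
  have hd₀ := h.disjoint i₀ hi₀
  have hW : (T i₀ ∪ X i₀).card = 2 * n := by
    rw [Finset.card_union_of_disjoint hd₀, (hc i₀ hi₀).1, (hc i₀ hi₀).2, two_mul]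
  -- Swaps connect `T i₀` to every `n`-subset of `T i₀ ∪ X i₀`; the induction is on the number of
  -- swaps needed.
  have key : ∀ m, ∀ S ∈ (T i₀ ∪ X i₀).powersetCard n, (S \ T i₀).card = m →
      ∃ j ∈ I, T j = S ∧ X j = (T i₀ ∪ X i₀) \ S := by
    intro m
    induction m with
    | zero =>
      intro S hS hm
      rw [Finset.mem_powersetCard] at hS
      rw [Finset.card_eq_zero, Finset.sdiff_eq_empty_iff_subset] at hm
      obtain rfl := Finset.eq_of_subset_of_card_le hm (by rw [hS.2, (hc i₀ hi₀).1])
      refine ⟨i₀, hi₀, rfl, ?_⟩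
      rw [Finset.union_sdiff_left, Finset.sdiff_eq_self_of_disjoint hd₀.symm]
    | succ m ih =>
      intro S hS hm
      rw [Finset.mem_powersetCard] at hS
      obtain ⟨x, hx⟩ := Finset.card_pos.1 (by omega : 0 < (S \ T i₀).card)
      have hcard : (T i₀ \ S).card = m + 1 := by
        have h1 := Finset.card_sdiff_add_card_inter S (T i₀)
        have h2 := Finset.card_sdiff_add_card_inter (T i₀) S
        rw [Finset.inter_comm] at h2
        have := (hc i₀ hi₀).1
        omega
      obtain ⟨t, ht⟩ := Finset.card_pos.1 (by omega : 0 < (T i₀ \ S).card)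
      rw [Finset.mem_sdiff] at hx ht
      have htx : t ≠ x := by rintro rfl; exact ht.2 hx.1
      obtain ⟨j, hj, hTj, hXj⟩ := ih (insert t (S.erase x)) (by
          rw [Finset.mem_powersetCard]
          refine ⟨Finset.insert_subset (Finset.mem_union_left _ ht.1)
            ((Finset.erase_subset _ _).trans hS.1), ?_⟩
          rw [Finset.card_insert_of_notMem (fun h => ht.2 (Finset.mem_of_mem_erase h)),
            Finset.card_erase_of_mem hx.1, hS.2]
          omega)
        (by
          rw [Finset.insert_sdiff_of_mem _ ht.1, Finset.erase_sdiff_comm,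
            Finset.card_erase_of_mem (Finset.mem_sdiff.2 hx), hm]
          rfl)
      obtain ⟨j', hj', hT', hX'⟩ := h.exists_swap hn hc hTY hXY hsep hj (t := t) (x := x)
        (by rw [hTj]; exact Finset.mem_insert_self _ _)
        (by
          rw [hXj, Finset.mem_sdiff]
          refine ⟨hS.1 hx.1, ?_⟩
          simp [htx.symm])
      refine ⟨j', hj', ?_, ?_⟩
      · rw [hT', hTj, Finset.erase_insert (fun h => ht.2 (Finset.mem_of_mem_erase h)),
          Finset.insert_erase hx.1]
      · rw [hX', hXj]
        ext z
        have h1 : z = t → z ∈ T i₀ ∧ z ∉ S := by rintro rfl; exact ht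
        have h2 : z = x → z ∈ S := by rintro rfl; exact hx.1
        have h3 : z = t → z ≠ x := by rintro rfl; exact htx
        simp only [Finset.mem_insert, Finset.mem_erase, Finset.mem_sdiff, Finset.mem_union]
        tauto
  refine ⟨T i₀ ∪ X i₀, hW, (Finset.eq_of_subset_of_card_le ?_ ?_).symm⟩
  · intro S hS
    obtain ⟨j, hj, hTj, -⟩ := key _ S hS rfl
    exact Finset.mem_image.2 ⟨j, hj, hTj⟩
  · rw [Finset.card_powersetCard, hW, ← hI]
    exact Finset.card_image_le

/-! ### Minimal covers and sunflower kernels -/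

/-- A family of sets such that every member of `𝒳` is disjoint from some member of it contains
a minimal one, which is the first half of a set-pair system. -/
theorem exists_minimal_disjoint_cover {α : Type*} [DecidableEq α] (𝒯 𝒳 : Finset (Finset α))
    (hcov : ∀ A ∈ 𝒳, ∃ T ∈ 𝒯, Disjoint A T) :
    ∃ 𝒯' ⊆ 𝒯, (∀ A ∈ 𝒳, ∃ T ∈ 𝒯', Disjoint A T) ∧
      ∃ X : Finset α → Finset α, (∀ T ∈ 𝒯', X T ∈ 𝒳) ∧ IsSetPairSystem 𝒯' id X := by
  obtain ⟨𝒯', h𝒯', hmin⟩ := Finset.exists_min_image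
    (𝒯.powerset.filter fun 𝒯' => ∀ A ∈ 𝒳, ∃ T ∈ 𝒯', Disjoint A T) Finset.card
    ⟨𝒯, Finset.mem_filter.2 ⟨Finset.mem_powerset_self _, hcov⟩⟩
  rw [Finset.mem_filter, Finset.mem_powerset] at h𝒯'
  -- By minimality, dropping `T` leaves some `A` unserved; this `A` is the partner of `T`.
  have key : ∀ T ∈ 𝒯', ∃ A ∈ 𝒳, Disjoint A T ∧ ∀ T' ∈ 𝒯', Disjoint A T' → T' = T := by
    intro T hT
    have hnot : ¬ ∀ A ∈ 𝒳, ∃ T' ∈ 𝒯'.erase T, Disjoint A T' := fun hcon => by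
      have := hmin (𝒯'.erase T) (Finset.mem_filter.2
        ⟨Finset.mem_powerset.2 ((Finset.erase_subset _ _).trans h𝒯'.1), hcon⟩)
      exact absurd (Finset.card_erase_lt_of_mem hT) (by omega)
    push Not at hnot
    obtain ⟨A, hA, hA'⟩ := hnot
    have huniq : ∀ T' ∈ 𝒯', Disjoint A T' → T' = T := fun T' hT' hd => by
      by_contra hne
      exact hA' T' (Finset.mem_erase.2 ⟨hne, hT'⟩) hd
    obtain ⟨T', hT', hd⟩ := h𝒯'.2 A hA
    exact ⟨A, hA, huniq T' hT' hd ▸ hd, huniq⟩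
  choose! X hX using key
  exact ⟨𝒯', h𝒯'.1, h𝒯'.2, X, fun T hT => (hX T hT).1, fun T hT => (hX T hT).2.1.symm,
    fun T hT T' hT' hd => (hX T' hT').2.2 T hT hd.symm⟩

/-- `T` is the kernel of a sunflower with `p` petals in `F`. -/
def IsSunflowerKernel {α : Type*} [DecidableEq α] (p : ℕ) (F : Finset (Finset α))
    (T : Finset α) : Prop :=
  ∃ 𝒮 ⊆ F, 𝒮.card = p ∧ (∀ B ∈ 𝒮, T ⊆ B) ∧ ∀ B ∈ 𝒮, ∀ B' ∈ 𝒮, B ≠ B' → B ∩ B' ⊆ T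

/-- If some `Z` with at most `q` elements meets every edge through `T` outside `T`, then some `z ∈ Z
\ T` lies in at least a `1/q` fraction of these edges, and `T` can be enlarged by `z`. This stops
before `|T| = k`, since a `k`-set is contained in at most one edge. -/
theorem exists_uncovered_link {α : Type*} [DecidableEq α] {q k : ℕ} {G : Finset (Finset α)}
    (hG : (G : Set (Finset α)).Sized k) (m : ℕ) :
    ∀ T : Finset α, T.card + m = k → q ^ m < (G.filter (T ⊆ ·)).card →
      ∃ T' : Finset α, T'.card < k ∧
        ∀ Z : Finset α, Z.card ≤ q → ∃ A ∈ G, T' ⊆ A ∧ A ∩ Z ⊆ T' := by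
  induction m with
  | zero =>
    intro T hT hlt
    have : G.filter (T ⊆ ·) ⊆ {T} := fun A hA => by
      rw [Finset.mem_filter] at hA
      rw [Finset.mem_singleton]
      refine (Finset.eq_of_subset_of_card_le hA.2 ?_).symm
      rw [hG hA.1]
      omega
    have := Finset.card_le_card this
    simp only [Finset.card_singleton] at this
    rw [pow_zero] at hlt
    omega
  | succ m ih =>
    intro T hT hlt
    by_cases hfree : ∀ Z : Finset α, Z.card ≤ q → ∃ A ∈ G, T ⊆ A ∧ A ∩ Z ⊆ T
    · exact ⟨T, by omega, hfree⟩
    push Not at hfree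
    obtain ⟨Z, hZ, hZA⟩ := hfree
    by_cases hz : ∃ z ∈ Z \ T, q ^ m < (G.filter (insert z T ⊆ ·)).card
    · obtain ⟨z, hz, hlt'⟩ := hz
      refine ih (insert z T) ?_ hlt'
      rw [Finset.card_insert_of_notMem (Finset.mem_sdiff.1 hz).2]
      omega
    push Not at hz
    have hsub : G.filter (T ⊆ ·) ⊆ (Z \ T).biUnion fun z => G.filter (insert z T ⊆ ·) := by
      intro A hA
      rw [Finset.mem_filter] at hA
      obtain ⟨z, hz1, hz2⟩ := Finset.not_subset.1 (hZA A hA.1 hA.2)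
      rw [Finset.mem_inter] at hz1
      exact Finset.mem_biUnion.2 ⟨z, Finset.mem_sdiff.2 ⟨hz1.2, hz2⟩,
        Finset.mem_filter.2 ⟨hA.1, Finset.insert_subset hz1.1 hA.2⟩⟩
    have h1 := (Finset.card_le_card hsub).trans (Finset.card_biUnion_le_card_mul _ _ _ hz)
    have h2 : (Z \ T).card * q ^ m ≤ q * q ^ m :=
      Nat.mul_le_mul_right _ ((Finset.card_le_card Finset.sdiff_subset).trans hZ)
    rw [pow_succ, mul_comm] at hlt
    omega

/-- Petals are chosen greedily, with `Z` the union of the earlier ones. As `|T| < k`, each new petal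
differs from those before it. -/
theorem isSunflowerKernel_of_uncovered {α : Type*} [DecidableEq α] {p k : ℕ}
    {G : Finset (Finset α)} (hG : (G : Set (Finset α)).Sized k) {T : Finset α} (hT : T.card < k)
    (hfree : ∀ Z : Finset α, Z.card ≤ p * k → ∃ A ∈ G, T ⊆ A ∧ A ∩ Z ⊆ T) :
    IsSunflowerKernel p G T := by
  have key : ∀ m ≤ p, IsSunflowerKernel m G T := by
    intro m
    induction m with
    | zero => exact fun _ => ⟨∅, by simp, by simp, by simp, by simp⟩
    | succ m ih =>
      intro hm
      obtain ⟨𝒮, hS, hc, hTS, hpair⟩ := ih (by omega)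
      have hZ : (𝒮.biUnion id).card ≤ p * k :=
        (Finset.card_biUnion_le_card_mul _ _ k fun B hB => (hG (hS hB)).le).trans
          (Nat.mul_le_mul_right _ (by omega))
      obtain ⟨A, hA, hTA, hAZ⟩ := hfree _ hZ
      have hAB : ∀ B ∈ 𝒮, A ∩ B ⊆ T := fun B hB =>
        (Finset.inter_subset_inter_left (Finset.subset_biUnion_of_mem id hB)).trans hAZ
      have hAS : A ∉ 𝒮 := fun h => by
        have := Finset.card_le_card (hAB A h)
        rw [Finset.inter_self, hG hA] at this
        omega
      refine ⟨insert A 𝒮, Finset.insert_subset hA hS, ?_, ?_, ?_⟩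
      · rw [Finset.card_insert_of_notMem hAS, hc]
      · intro B hB
        rcases Finset.mem_insert.1 hB with rfl | hB
        exacts [hTA, hTS B hB]
      · intro B hB B' hB' hne
        rcases Finset.mem_insert.1 hB with h | h <;>
          rcases Finset.mem_insert.1 hB' with h' | h'
        · exact absurd (h.trans h'.symm) hne
        · exact h ▸ hAB B' h'
        · rw [Finset.inter_comm]; exact h' ▸ hAB B h
        · exact hpair B h B' h' hne
  exact key p le_rfl

theorem IsSunflowerKernel.mono {α : Type*} [DecidableEq α] {p : ℕ} {G F : Finset (Finset α)}
    {T : Finset α} (h : IsSunflowerKernel p G T) (hGF : G ⊆ F) : IsSunflowerKernel p F T := by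
  obtain ⟨𝒮, hS, h⟩ := h
  exact ⟨𝒮, hS.trans hGF, h⟩

/-- An edge disjoint from many edges is disjoint from the kernel of a large sunflower. -/
theorem exists_isSunflowerKernel_disjoint {α : Type*} [DecidableEq α] {p k : ℕ} (hp : 0 < p)
    {F : Finset (Finset α)} (hF : (F : Set (Finset α)).Sized k) {A : Finset α}
    (hA : (p * k) ^ k < (F.filter (Disjoint A ·)).card) :
    ∃ T : Finset α, T.card < k ∧ IsSunflowerKernel p F T ∧ Disjoint A T := by
  have hG : ((F.filter (Disjoint A ·) : Finset (Finset α)) : Set (Finset α)).Sized k :=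
    fun B hB => hF (Finset.mem_filter.1 hB).1
  obtain ⟨T, hT, hfree⟩ := exists_uncovered_link (q := p * k) hG k ∅ (by simp) (by simpa using hA)
  have hker := isSunflowerKernel_of_uncovered hG hT hfree
  refine ⟨T, hT, hker.mono (Finset.filter_subset _ _), ?_⟩
  obtain ⟨𝒮, hS, hc, hTS, -⟩ := hker
  obtain ⟨B, hB⟩ := Finset.card_pos.1 (by omega : 0 < 𝒮.card)
  exact (Finset.mem_filter.1 (hS hB)).2.mono_right (hTS B hB)

/-- Few edges are disjoint from the kernel of a large sunflower. -/
theorem IsSunflowerKernel.card_disjoint_mul_le {α : Type*} [DecidableEq α] {p k s : ℕ}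
    {F : Finset (Finset α)} (hF : (F : Set (Finset α)).Sized k)
    (hs : ∀ A ∈ F, (F.filter (Disjoint A ·)).card ≤ s) {T : Finset α}
    (hT : IsSunflowerKernel p F T) :
    (F.filter (Disjoint · T)).card * (p - k) ≤ p * s := by
  obtain ⟨𝒮, hS, hc, hTS, hpair⟩ := hT
  rw [← hc]
  refine Finset.card_mul_le_card_mul (fun A B => Disjoint A B) ?_ ?_
  · intro A hA
    rw [Finset.mem_filter] at hA
    -- `A` misses the kernel, and petals are disjoint off the kernel, so each element of `A` lies in
    -- at most one petal.
    have hinter : (𝒮.filter fun B => ¬ Disjoint A B).card ≤ k := by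
      rw [← hF hA.1]
      refine Finset.card_le_card_of_forall_subsingleton (fun B z => z ∈ B)
        (fun B hB => Finset.not_disjoint_iff.1 (Finset.mem_filter.1 hB).2) ?_
      rintro z hz B ⟨hB, hzB⟩ B' ⟨hB', hzB'⟩
      by_contra hne
      have := hpair B (Finset.mem_filter.1 hB).1 B' (Finset.mem_filter.1 hB').1 hne
        (Finset.mem_inter.2 ⟨hzB, hzB'⟩)
      exact Finset.disjoint_left.1 hA.2 hz this
    have := Finset.card_filter_add_card_filter_not (s := 𝒮) (fun B => Disjoint A B)
    rw [Finset.bipartiteAbove]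
    omega
  · intro B hB
    rw [Finset.bipartiteBelow]
    refine le_trans (Finset.card_le_card fun A hA => ?_) (hs B (hS hB))
    simp only [Finset.mem_filter] at hA ⊢
    exact ⟨hA.1.1, hA.2.symm⟩

/-! ### The ground set of a large family -/

/-- Since `(N-1)(1 + 1/(8N)) ≤ N - 7/8`, any `N-1` kernels account for at most `(N - 7/8)s` edges.
The deficit `7s/8` drives the later counts. -/
theorem sum_card_disjoint_mul_le {α : Type*} [DecidableEq α] {N s : ℕ}
    {F 𝒯 : Finset (Finset α)}
    (hn : ∀ T ∈ 𝒯, 8 * N * (F.filter (Disjoint · T)).card ≤ (8 * N + 1) * s)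
    (h𝒯 : 𝒯.card + 1 ≤ N) :
    8 * (∑ T ∈ 𝒯, (F.filter (Disjoint · T)).card) + 7 * s ≤ 8 * N * s := by
  have h1 := Finset.sum_le_card_nsmul 𝒯 _ _ hn
  rw [← Finset.mul_sum, smul_eq_mul] at h1
  set σ := ∑ T ∈ 𝒯, (F.filter (Disjoint · T)).card
  obtain ⟨m, rfl⟩ : ∃ m, N = m + 1 := ⟨N - 1, by omega⟩
  have h2 : 𝒯.card * ((8 * (m + 1) + 1) * s) ≤ m * ((8 * (m + 1) + 1) * s) :=
    Nat.mul_le_mul_right _ (by omega)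
  have h3 : (m + 1) * (8 * σ + 7 * s) ≤ (m + 1) * (8 * (m + 1) * s) := by
    nlinarith
  exact Nat.le_of_mul_le_mul_left h3 (by omega)

/-- In a large family there is a `(2k-2)`-set `W` such that few edges are disjoint from any given
`(k-1)`-subset of `W`, and all but boundedly many edges are disjoint from some such subset. -/
theorem exists_ground_set {α : Type*} [DecidableEq α] {k N s p c : ℕ} (hk : 2 < k)
    (hN : N = (2 * (k - 1)).choose (k - 1)) (hp : p = k + 8 * N * k)
    (hc : c = 2 ^ ((2 * k).choose k * k)) (hsc : 8 * c < s)
    {F : Finset (Finset α)} (hF : (F : Set (Finset α)).Sized k)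
    (hs : ∀ A ∈ F, (F.filter (Disjoint A ·)).card ≤ s)
    (hR : ∀ A ∈ F, (p * k) ^ k < (F.filter (Disjoint A ·)).card)
    (hcard : (s + 1) * N ≤ F.card) :
    ∃ W : Finset α, W.card = 2 * (k - 1) ∧
      (∀ T ∈ W.powersetCard (k - 1),
        8 * N * (F.filter (Disjoint · T)).card ≤ (8 * N + 1) * s) ∧
      ∃ F₀ : Finset (Finset α), F₀.card ≤ c ∧
        ∀ A ∈ F, A ∈ F₀ ∨ ∃ T ∈ W.powersetCard (k - 1), Disjoint A T := by
  have hp0 : 0 < p := by omega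
  choose! T₀ hT₀ using fun A hA => exists_isSunflowerKernel_disjoint hp0 hF (hR A hA)
  obtain ⟨𝒯, h𝒯, hcov, X, hX, hsys⟩ := exists_minimal_disjoint_cover (F.image T₀) F
    fun A hA => ⟨T₀ A, Finset.mem_image_of_mem _ hA, (hT₀ A hA).2.2⟩
  have hker : ∀ T ∈ 𝒯, T.card < k ∧ IsSunflowerKernel p F T := by
    intro T hT
    obtain ⟨A, hA, rfl⟩ := Finset.mem_image.1 (h𝒯 hT)
    exact ⟨(hT₀ A hA).1, (hT₀ A hA).2.1⟩
  have hfew : ∀ T ∈ 𝒯, 8 * N * (F.filter (Disjoint · T)).card ≤ (8 * N + 1) * s := by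
    intro T hT
    have h := (hker T hT).2.card_disjoint_mul_le hF hs
    -- The choice of `p` makes `p / (p - k) = 1 + 1/(8N)`.
    rw [hp, Nat.add_sub_cancel_left] at h
    have hk0 : 0 < k := by omega
    refine le_of_mul_le_mul_left ?_ hk0
    linarith
  have h𝒯card : 𝒯.card ≤ (2 * k).choose k := hsys.card_le (fun T hT => (hker T hT).1.le)
    fun T hT => (hF (hX T hT)).le
  set U := 𝒯.biUnion id
  have hUcard : U.card ≤ (2 * k).choose k * k :=
    (Finset.card_biUnion_le_card_mul _ _ k fun T hT => (hker T hT).1.le).trans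
      (Nat.mul_le_mul_right _ h𝒯card)
  have htrace : ∀ A : Finset α, ∀ T ∈ 𝒯, Disjoint (A ∩ U) T ↔ Disjoint A T := by
    intro A T hT
    have hTU : T ⊆ U := Finset.subset_biUnion_of_mem id hT
    rw [Finset.disjoint_iff_inter_eq_empty, Finset.disjoint_iff_inter_eq_empty,
      Finset.inter_assoc, Finset.inter_eq_right.2 hTU]
  -- Minimizing again over the small traces gives pairs with both sizes at most `k-1`, which
  -- improves the bound `(2k).choose k` to `N`.
  obtain ⟨𝒯', h𝒯', hcov', X', hX', hsys'⟩ := exists_minimal_disjoint_cover 𝒯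
    ((F.image (· ∩ U)).filter fun Y => Y.card ≤ k - 1) fun Y hY => by
      obtain ⟨A, hA, rfl⟩ := Finset.mem_image.1 (Finset.mem_filter.1 hY).1
      obtain ⟨T, hT, hd⟩ := hcov A hA
      exact ⟨T, hT, (htrace A T hT).2 hd⟩
  have hF₀ : (F.filter (· ⊆ U)).card ≤ c := by
    rw [hc]
    calc (F.filter (· ⊆ U)).card ≤ U.powerset.card := Finset.card_le_card fun A hA =>
          Finset.mem_powerset.2 (Finset.mem_filter.1 hA).2
      _ = 2 ^ U.card := Finset.card_powerset U
      _ ≤ _ := Nat.pow_le_pow_right (by norm_num) hUcard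
  have hcov'' : ∀ A ∈ F, A ∈ F.filter (· ⊆ U) ∨ ∃ T ∈ 𝒯', Disjoint A T := by
    intro A hA
    by_cases hAU : A ⊆ U
    · exact Or.inl (Finset.mem_filter.2 ⟨hA, hAU⟩)
    · right
      have hlt : (A ∩ U).card < A.card := Finset.card_lt_card
        ⟨Finset.inter_subset_left, fun h => hAU (h.trans Finset.inter_subset_right)⟩
      rw [hF hA] at hlt
      obtain ⟨T, hT, hd⟩ := hcov' (A ∩ U) (Finset.mem_filter.2
        ⟨Finset.mem_image_of_mem _ hA, by omega⟩)
      exact ⟨T, hT, (htrace A T (h𝒯' hT)).1 hd⟩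
  have hTcard : ∀ T ∈ 𝒯', (id T : Finset α).card ≤ k - 1 := fun T hT => by
    have := (hker T (h𝒯' hT)).1
    rw [id]
    omega
  have hXcard : ∀ T ∈ 𝒯', (X' T).card ≤ k - 1 := fun T hT => (Finset.mem_filter.1 (hX' T hT)).2
  have hle : 𝒯'.card ≤ N := hN ▸ hsys'.card_le hTcard hXcard
  -- With at most `N-1` kernels, `|F| ≤ c + (N - 7/8)s < (s+1)N`, because `8c < s`.
  have hge : N ≤ 𝒯'.card := by
    by_contra hlt
    have h1 := sum_card_disjoint_mul_le (fun T hT => hfew T (h𝒯' hT))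
      (by omega : 𝒯'.card + 1 ≤ N)
    have h2 : F ⊆ F.filter (· ⊆ U) ∪ 𝒯'.biUnion fun T => F.filter (Disjoint · T) := by
      intro A hA
      rw [Finset.mem_union, Finset.mem_biUnion]
      refine (hcov'' A hA).imp_right ?_
      rintro ⟨T, hT, hd⟩
      exact ⟨T, hT, Finset.mem_filter.2 ⟨hA, hd⟩⟩
    have h3 := (Finset.card_le_card h2).trans (Finset.card_union_le _ _)
    have h4 := Finset.card_biUnion_le (s := 𝒯') (t := fun T => F.filter (Disjoint · T))
    have h5 : (s + 1) * N = N * s + N := by ring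
    have h6 : 8 * N * s = 8 * (N * s) := by ring
    omega
  obtain ⟨W, hW, himage⟩ := hsys'.exists_image_eq_powersetCard (by omega : 0 < k - 1) hTcard hXcard
    (by rw [← hN]; omega)
  rw [Finset.image_id] at himage
  refine ⟨W, hW, ?_⟩
  rw [← himage]
  exact ⟨fun T hT => hfew T (h𝒯' hT), _, hF₀, hcov''⟩

/-- An edge that misses `W \ S` and no other `(k-1)`-subset of `W` has trace exactly `S`. The other
`N-1` subsets account for at most `(N - 7/8)s` edges and `F₀` for at most `c`, so the rest have
trace `S`. -/
theorem le_card_filter_inter_eq {α : Type*} [DecidableEq α] {k N s c : ℕ} (hk : 2 < k)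
    (hN : N = (2 * (k - 1)).choose (k - 1))
    {F F₀ : Finset (Finset α)} (hcard : (s + 1) * N ≤ F.card)
    {W : Finset α} (hW : W.card = 2 * (k - 1))
    (hfew : ∀ T ∈ W.powersetCard (k - 1),
        8 * N * (F.filter (Disjoint · T)).card ≤ (8 * N + 1) * s)
    (hF₀ : F₀.card ≤ c)
    (hcov : ∀ A ∈ F, A ∈ F₀ ∨ ∃ T ∈ W.powersetCard (k - 1), Disjoint A T)
    {S : Finset α} (hS : S ∈ W.powersetCard (k - 1)) :
    7 * s ≤ 8 * (F.filter (· ∩ W = S)).card + 8 * c := by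
  obtain ⟨hSW, hSc⟩ := Finset.mem_powersetCard.1 hS
  have hT₀c : (W \ S).card = k - 1 := by
    rw [Finset.card_sdiff_of_subset hSW]; omega
  have hT₀ : W \ S ∈ W.powersetCard (k - 1) :=
    Finset.mem_powersetCard.2 ⟨Finset.sdiff_subset, hT₀c⟩
  have hN' : ((W.powersetCard (k - 1)).erase (W \ S)).card + 1 ≤ N := by
    rw [Finset.card_erase_add_one hT₀, Finset.card_powersetCard, hW, hN]
  have h1 := sum_card_disjoint_mul_le (fun T hT => hfew T (Finset.mem_of_mem_erase hT)) hN'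
  have h2 : F ⊆ F₀ ∪ ((W.powersetCard (k - 1)).erase (W \ S)).biUnion
      (fun T => F.filter (Disjoint · T)) ∪ F.filter (· ∩ W = S) := by
    intro A hA
    rw [Finset.mem_union, Finset.mem_union, Finset.mem_biUnion]
    by_contra! hcon
    obtain ⟨⟨hA₀, hA₁⟩, hA₂⟩ := hcon
    have hA₁' : ∀ T ∈ W.powersetCard (k - 1), Disjoint A T → T = W \ S := fun T hT hd => by
      by_contra hne
      exact hA₁ T (Finset.mem_erase.2 ⟨hne, hT⟩) (Finset.mem_filter.2 ⟨hA, hd⟩)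
    obtain ⟨T, hT, hd⟩ := (hcov A hA).resolve_left hA₀
    obtain rfl := hA₁' T hT hd
    have hsub : A ∩ W ⊆ S := fun z hz => by
      rw [Finset.mem_inter] at hz
      by_contra hzS
      exact Finset.disjoint_left.1 hd hz.1 (Finset.mem_sdiff.2 ⟨hz.2, hzS⟩)
    have hnsub : ¬ S ⊆ A ∩ W := fun h =>
      hA₂ (Finset.mem_filter.2 ⟨hA, Finset.Subset.antisymm hsub h⟩)
    obtain ⟨z, hzS, hzA⟩ := Finset.not_subset.1 hnsub
    have hzA' : z ∉ A := fun h => hzA (Finset.mem_inter.2 ⟨h, hSW hzS⟩)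
    obtain ⟨y, hy⟩ := Finset.card_pos.1 (by omega : 0 < (W \ S).card)
    have hz : z ∉ W \ S := fun h => (Finset.mem_sdiff.1 h).2 hzS
    -- If `A` misses some `z ∈ S`, exchanging an element of `W \ S` for `z` gives a second
    -- `(k-1)`-subset that `A` misses.
    have := hA₁' (insert z ((W \ S).erase y)) (by
        rw [Finset.mem_powersetCard]
        refine ⟨Finset.insert_subset (hSW hzS)
          ((Finset.erase_subset _ _).trans Finset.sdiff_subset), ?_⟩
        rw [Finset.card_insert_of_notMem fun h => hz (Finset.mem_of_mem_erase h),
          Finset.card_erase_of_mem hy]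
        omega)
      (by
        rw [Finset.disjoint_insert_right]
        exact ⟨hzA', hd.mono_right (Finset.erase_subset _ _)⟩)
    exact hz (this ▸ Finset.mem_insert_self _ _)
  have h3 := Finset.card_le_card h2
  have h4 := Finset.card_union_le (F₀ ∪ ((W.powersetCard (k - 1)).erase (W \ S)).biUnion
      (fun T => F.filter (Disjoint · T))) (F.filter (· ∩ W = S))
  have h5 := Finset.card_union_le F₀ (((W.powersetCard (k - 1)).erase (W \ S)).biUnion
      (fun T => F.filter (Disjoint · T)))
  have h6 := Finset.card_biUnion_le (s := (W.powersetCard (k - 1)).erase (W \ S))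
    (t := fun T => F.filter (Disjoint · T))
  have h7 : (s + 1) * N = N * s + N := by ring
  have h8 : 8 * N * s = 8 * (N * s) := by ring
  omega

/-- An edge with trace `T` is `T` plus one point, so it meets `A` only if that point is one of the
`k` elements of `A`. -/
theorem card_filter_inter_eq_le {α : Type*} [DecidableEq α] {k : ℕ} (hk : 0 < k)
    {F : Finset (Finset α)} (hF : (F : Set (Finset α)).Sized k) {W A T : Finset α}
    (hA : A.card = k) (hT : T.card = k - 1) (hAT : Disjoint A T) :
    (F.filter (· ∩ W = T)).card ≤
      ((F.filter (· ∩ W = T)).filter (Disjoint A ·)).card + k := by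
  rw [← Finset.card_filter_add_card_filter_not (s := F.filter (· ∩ W = T)) (Disjoint A ·)]
  refine Nat.add_le_add_left (le_trans (Finset.card_le_card (t := A.image (insert · T)) ?_)
    (Finset.card_image_le.trans hA.le)) _
  intro B hB
  rw [Finset.mem_filter, Finset.mem_filter, Finset.not_disjoint_iff] at hB
  obtain ⟨⟨hBF, hBW⟩, z, hzA, hzB⟩ := hB
  refine Finset.mem_image.2 ⟨z, hzA, Finset.eq_of_subset_of_card_le
    (Finset.insert_subset hzB (hBW ▸ Finset.inter_subset_left)) ?_⟩
  rw [hF hBF, Finset.card_insert_of_notMem (Finset.disjoint_left.1 hAT hzA), hT]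
  omega

/-- If `|A ∩ W| < k-1`, then `W \ A` contains two `(k-1)`-sets, and `A` misses at least `2(7s/8 - c
- k) > s` edges with these traces. Conversely `A` misses some edge, which also takes at least `k-1`
of the `2k-2` points of `W`. -/
theorem card_inter_eq_of_le_card_filter {α : Type*} [DecidableEq α] {k s c : ℕ} (hk : 2 < k)
    (hsc : 8 * c + 8 * k < s)
    {F : Finset (Finset α)} (hF : (F : Set (Finset α)).Sized k)
    (hs : ∀ A ∈ F, (F.filter (Disjoint A ·)).card ≤ s)
    (hR : ∀ A ∈ F, 0 < (F.filter (Disjoint A ·)).card)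
    {W : Finset α} (hW : W.card = 2 * (k - 1))
    (hlarge : ∀ S ∈ W.powersetCard (k - 1), 7 * s ≤ 8 * (F.filter (· ∩ W = S)).card + 8 * c)
    {A : Finset α} (hA : A ∈ F) : (A ∩ W).card = k - 1 := by
  have hge : ∀ A ∈ F, k - 1 ≤ (A ∩ W).card := by
    intro A hA
    by_contra! hlt
    have hWA : k ≤ (W \ A).card := by
      have := Finset.card_sdiff_add_card_inter W A
      rw [Finset.inter_comm] at this
      omega
    have hcard : 1 < ((W \ A).powersetCard (k - 1)).card := by
      rw [Finset.card_powersetCard]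
      calc 1 < k := by omega
        _ = k.choose (k - 1) := by
          rw [Nat.choose_symm (by omega : 1 ≤ k), Nat.choose_one_right]
        _ ≤ _ := Nat.choose_le_choose _ hWA
    obtain ⟨T₁, hT₁, T₂, hT₂, hne⟩ := Finset.one_lt_card.1 hcard
    rw [Finset.mem_powersetCard, Finset.subset_sdiff] at hT₁ hT₂
    have h1 := hlarge T₁ (Finset.mem_powersetCard.2 ⟨hT₁.1.1, hT₁.2⟩)
    have h2 := hlarge T₂ (Finset.mem_powersetCard.2 ⟨hT₂.1.1, hT₂.2⟩)
    have h3 := card_filter_inter_eq_le (by omega) hF (W := W) (hF hA) hT₁.2 hT₁.1.2.symm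
    have h4 := card_filter_inter_eq_le (by omega) hF (W := W) (hF hA) hT₂.2 hT₂.1.2.symm
    have hd : Disjoint ((F.filter (· ∩ W = T₁)).filter (Disjoint A ·))
        ((F.filter (· ∩ W = T₂)).filter (Disjoint A ·)) := by
      rw [Finset.disjoint_left]
      intro B hB hB'
      simp only [Finset.mem_filter] at hB hB'
      exact hne (hB.1.2.symm.trans hB'.1.2)
    have h5 := Finset.card_union_of_disjoint hd
    have h6 := (Finset.card_le_card (Finset.union_subset
      (Finset.filter_subset_filter (Disjoint A ·) (Finset.filter_subset (· ∩ W = T₁) F))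
      (Finset.filter_subset_filter (Disjoint A ·)
        (Finset.filter_subset (· ∩ W = T₂) F)))).trans (hs A hA)
    omega
  refine le_antisymm ?_ (hge A hA)
  by_contra! hlt
  obtain ⟨B, hB⟩ := Finset.card_pos.1 (hR A hA)
  rw [Finset.mem_filter] at hB
  have h1 := hge B hB.1
  have h2 : (A ∩ W ∪ B ∩ W).card ≤ W.card := Finset.card_le_card
    (Finset.union_subset Finset.inter_subset_right Finset.inter_subset_right)
  rw [Finset.card_union_of_disjoint
    (hB.2.mono Finset.inter_subset_left Finset.inter_subset_left)] at h2
  omega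

/-! ### The families `M_f` -/

theorem union_singleton_inter_eq {α : Type*} [DecidableEq α] {S A : Finset α} {x : α} (hS : S ⊆ A)
    (hx : x ∉ A) : (S ∪ {x}) ∩ A = S := by
  rw [Finset.union_inter_distrib_right, Finset.inter_eq_left.2 hS,
    Finset.singleton_inter_of_notMem hx, Finset.union_empty]

theorem union_singleton_injOn {α : Type*} [DecidableEq α] {S A : Finset α} (hS : S ⊆ A)
    {t : Finset α} (ht : ∀ x ∈ t, x ∉ A) : Set.InjOn (fun x => S ∪ {x}) (t : Set α) := by
  intro y hy z hz hyz
  have : y ∈ S ∪ {z} := by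
    rw [← show S ∪ {y} = S ∪ {z} from hyz]; simp
  rw [Finset.mem_union, Finset.mem_singleton] at this
  exact this.resolve_left fun h => ht y hy (hS h)

theorem disjoint_union_singleton_iff {α : Type*} [DecidableEq α] {S T : Finset α} {x y : α} :
    Disjoint (S ∪ {x}) (T ∪ {y}) ↔ Disjoint S T ∧ x ∉ T ∧ y ∉ S ∧ x ≠ y := by
  simp only [Finset.disjoint_union_left, Finset.disjoint_union_right,
    Finset.disjoint_singleton_left, Finset.disjoint_singleton_right, Finset.mem_union,
    Finset.mem_singleton]
  grind

/-- Put `f S = {x ∉ W : S ∪ {x} ∈ F}`. For `x ∈ f (W \ S)` the edge `(W \ S) ∪ {x}` misses `S ∪ {y}`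
for every `y ∈ f S` other than `x`, so `|f S \ {x}| ≤ s` and `|f S| ≤ s+1`. Summing over `S`, the
size of `F` forces equality throughout. -/
theorem isDoubleStarFamily_of_card_inter_eq {α : Type*} [DecidableEq α] {k N s : ℕ} (hk : 2 < k)
    (hN : N = (2 * (k - 1)).choose (k - 1))
    {F : Finset (Finset α)} (hF : (F : Set (Finset α)).Sized k)
    (hs : ∀ A ∈ F, (F.filter (Disjoint A ·)).card ≤ s)
    (hcard : (s + 1) * N ≤ F.card)
    {W : Finset α} (hW : W.card = 2 * (k - 1)) (hinter : ∀ A ∈ F, (A ∩ W).card = k - 1)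
    (hne : ∀ S ∈ W.powersetCard (k - 1), (F.filter (· ∩ W = S)).Nonempty) :
    IsDoubleStarFamily k s F := by
  set P := W.powersetCard (k - 1) with hP
  have hPc : P.card = N := by rw [hP, Finset.card_powersetCard, hW, hN]
  have hcompl : ∀ S ∈ P, W \ S ∈ P := fun S hS => by
    rw [hP, Finset.mem_powersetCard] at hS ⊢
    refine ⟨Finset.sdiff_subset, ?_⟩
    rw [Finset.card_sdiff_of_subset hS.1]
    omega
  set f : Finset α → Finset α := fun S => (F.biUnion id \ W).filter fun x => S ∪ {x} ∈ F with hf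
  have hmem : ∀ S x, x ∈ f S ↔ x ∉ W ∧ S ∪ {x} ∈ F := by
    intro S x
    rw [hf, Finset.mem_filter, Finset.mem_sdiff, Finset.mem_biUnion]
    exact ⟨fun h => ⟨h.1.2, h.2⟩, fun h => ⟨⟨⟨_, h.2, by simp⟩, h.1⟩, h.2⟩⟩
  have hrep : ∀ A ∈ F, A ∩ W ∈ P ∧ ∃ x ∈ f (A ∩ W), (A ∩ W) ∪ {x} = A := by
    intro A hA
    refine ⟨Finset.mem_powersetCard.2 ⟨Finset.inter_subset_right, hinter A hA⟩, ?_⟩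
    have h1 : (A \ W).card = 1 := by
      have h1 := Finset.card_sdiff_add_card_inter A W
      have h2 := hinter A hA
      have h3 := hF hA
      omega
    obtain ⟨x, hx⟩ := Finset.card_eq_one.1 h1
    have h2 : (A ∩ W) ∪ {x} = A := by
      rw [← hx, Finset.union_comm, Finset.sdiff_union_inter]
    have hxW : x ∈ A \ W := hx ▸ Finset.mem_singleton_self x
    exact ⟨x, (hmem _ _).2 ⟨(Finset.mem_sdiff.1 hxW).2, h2.symm ▸ hA⟩, h2⟩
  have hfam : F = doubleStarFamily k W f := by
    ext A
    simp only [doubleStarFamily, Finset.mem_biUnion, Finset.mem_image]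
    constructor
    · intro hA
      exact ⟨_, hrep A hA⟩
    · rintro ⟨S, -, x, hx, rfl⟩
      exact ((hmem S x).1 hx).2
  have hfne : ∀ S ∈ P, (f S).Nonempty := by
    intro S hS
    obtain ⟨A, hA⟩ := hne S hS
    rw [Finset.mem_filter] at hA
    obtain ⟨-, x, hx, -⟩ := hrep A hA.1
    exact ⟨x, hA.2 ▸ hx⟩
  have herase : ∀ S ∈ P, ∀ x ∈ f (W \ S), ((f S).erase x).card ≤ s := by
    intro S hS x hx
    have hSW := (Finset.mem_powersetCard.1 hS).1
    rw [hmem] at hx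
    refine le_trans (Finset.card_le_card_of_injOn (S ∪ {·}) ?_ ?_) (hs _ hx.2)
    · intro y hy
      rw [Finset.mem_coe, Finset.mem_erase, hmem] at hy
      rw [Finset.mem_coe, Finset.mem_filter]
      refine ⟨hy.2.2, ?_⟩
      exact disjoint_union_singleton_iff.2 ⟨Finset.sdiff_disjoint, fun h => hx.1 (hSW h),
        fun h => hy.2.1 (Finset.mem_sdiff.1 h).1, hy.1.symm⟩
    · exact union_singleton_injOn hSW fun y hy => ((hmem S y).1 (Finset.mem_of_mem_erase hy)).1
  have hfle : ∀ S ∈ P, (f S).card ≤ s + 1 := by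
    intro S hS
    obtain ⟨x, hx⟩ := hfne _ (hcompl S hS)
    have h1 := herase S hS x hx
    have h2 := Finset.pred_card_le_card_erase (s := f S) (a := x)
    omega
  have hsum : ∑ S ∈ P, (f S).card = ∑ _S ∈ P, (s + 1) := by
    refine le_antisymm (Finset.sum_le_sum hfle) ?_
    rw [Finset.sum_const, hPc, smul_eq_mul, mul_comm]
    refine hcard.trans ?_
    calc F.card = (doubleStarFamily k W f).card := congrArg _ hfam
      _ ≤ ∑ S ∈ P, ((f S).image fun x => S ∪ {x}).card := Finset.card_biUnion_le
      _ ≤ _ := Finset.sum_le_sum fun S _ => Finset.card_image_le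
  have hfeq : ∀ S ∈ P, (f S).card = s + 1 := (Finset.sum_eq_sum_iff_of_le hfle).1 hsum
  -- If `x ∉ f S`, erasing `x` removes nothing, and `s+1 ≤ s` would follow.
  have hsub : ∀ S ∈ P, f (W \ S) ⊆ f S := by
    intro S hS x hx
    by_contra hxS
    have := herase S hS x hx
    rw [Finset.erase_eq_of_notMem hxS, hfeq S hS] at this
    omega
  have hsymm : ∀ S ∈ P, f S = f (W \ S) := fun S hS =>
    (Finset.eq_of_subset_of_card_le (hsub S hS)
      (by rw [hfeq S hS, hfeq _ (hcompl S hS)])).symm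
  obtain ⟨S₀, hS₀⟩ : P.Nonempty := by
    rw [← Finset.card_pos, hPc, hN]
    exact Nat.choose_pos (by omega)
  refine ⟨W, P.biUnion f, f, ?_, by omega, ?_, ?_, hfam⟩
  · rw [Finset.disjoint_biUnion_right]
    intro S _
    rw [Finset.disjoint_right]
    exact fun x hx => ((hmem S x).1 hx).1
  · rw [← hfeq S₀ hS₀]
    exact Finset.card_le_card (Finset.subset_biUnion_of_mem f hS₀)
  · intro S hS
    exact ⟨Finset.mem_powersetCard.2 ⟨Finset.subset_biUnion_of_mem f hS, hfeq S hS⟩, hsymm S hS⟩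

theorem IsDoubleStarFamily.sized {α : Type*} [DecidableEq α] {k s : ℕ} (hk : 0 < k)
    {F : Finset (Finset α)} (h : IsDoubleStarFamily k s F) : (F : Set (Finset α)).Sized k := by
  obtain ⟨A, B, f, hAB, hA, hB, hf, rfl⟩ := h
  intro E hE
  simp only [doubleStarFamily, Finset.mem_coe, Finset.mem_biUnion, Finset.mem_image] at hE
  obtain ⟨S, hS, x, hx, rfl⟩ := hE
  have hxB := (Finset.mem_powersetCard.1 (hf S hS).1).1 hx
  rw [Finset.mem_powersetCard] at hS
  rw [Finset.card_union_of_disjoint (Finset.disjoint_singleton_right.2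
    fun h => Finset.disjoint_left.1 hAB (hS.1 h) hxB), hS.2, Finset.card_singleton]
  omega

theorem IsDoubleStarFamily.card_eq {α : Type*} [DecidableEq α] {k s : ℕ}
    {F : Finset (Finset α)} (h : IsDoubleStarFamily k s F) :
    F.card = (s + 1) * (2 * k - 2).choose (k - 1) := by
  obtain ⟨A, B, f, hAB, hA, hB, hf, rfl⟩ := h
  have hfA : ∀ S ∈ A.powersetCard (k - 1), ∀ x ∈ f S, x ∉ A := fun S hS x hx =>
    Finset.disjoint_right.1 hAB ((Finset.mem_powersetCard.1 (hf S hS).1).1 hx)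
  have hsub : ∀ S ∈ A.powersetCard (k - 1), S ⊆ A := fun S hS => (Finset.mem_powersetCard.1 hS).1
  rw [doubleStarFamily, Finset.card_biUnion]
  · rw [Finset.sum_const_nat (m := s + 1), Finset.card_powersetCard, hA, mul_comm]
    intro S hS
    rw [Finset.card_image_of_injOn (union_singleton_injOn (hsub S hS) (hfA S hS)),
      (Finset.mem_powersetCard.1 (hf S hS).1).2]
  · intro S hS T hT hne
    refine Finset.disjoint_left.2 fun E hE hE' => ?_
    obtain ⟨x, hx, rfl⟩ := Finset.mem_image.1 hE
    obtain ⟨y, hy, hxy⟩ := Finset.mem_image.1 hE'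
    apply hne
    rw [← union_singleton_inter_eq (hsub S hS) (hfA S hS x hx), ← hxy,
      union_singleton_inter_eq (hsub T hT) (hfA T hT y hy)]

/-- The only `(k-1)`-subset of `A` disjoint from `S` is `A \ S`. So `S ∪ {x}` misses exactly the
edges `(A \ S) ∪ {y}` with `y ∈ f (A \ S)` and `y ≠ x`, and `x` itself lies in `f (A \ S) = f S`. -/
theorem IsDoubleStarFamily.isAlmostIntersecting {α : Type*} [DecidableEq α] {k s : ℕ}
    {F : Finset (Finset α)} (h : IsDoubleStarFamily k s F) : IsAlmostIntersecting s s F := by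
  obtain ⟨A, B, f, hAB, hA, hB, hf, rfl⟩ := h
  have hfA : ∀ S ∈ A.powersetCard (k - 1), ∀ x ∈ f S, x ∉ A := fun S hS x hx =>
    Finset.disjoint_right.1 hAB ((Finset.mem_powersetCard.1 (hf S hS).1).1 hx)
  have hsub : ∀ S ∈ A.powersetCard (k - 1), S ⊆ A := fun S hS => (Finset.mem_powersetCard.1 hS).1
  intro E hE
  suffices hcard : ((doubleStarFamily k A f).filter fun B => E ∩ B = ∅).card = s from
    ⟨hcard.ge, hcard.le⟩
  obtain ⟨S, hS, hE⟩ := Finset.mem_biUnion.1 hE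
  obtain ⟨x, hx, rfl⟩ := Finset.mem_image.1 hE
  have hSc : A \ S ∈ A.powersetCard (k - 1) := by
    rw [Finset.mem_powersetCard] at hS ⊢
    refine ⟨Finset.sdiff_subset, ?_⟩
    rw [Finset.card_sdiff_of_subset hS.1]
    omega
  have hset : (doubleStarFamily k A f).filter (fun B => (S ∪ {x}) ∩ B = ∅) =
      ((f (A \ S)).erase x).image fun y => (A \ S) ∪ {y} := by
    ext E
    simp only [doubleStarFamily, Finset.mem_filter, Finset.mem_biUnion, Finset.mem_image,
      ← Finset.disjoint_iff_inter_eq_empty]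
    constructor
    · rintro ⟨⟨T, hT, y, hy, rfl⟩, hd⟩
      rw [disjoint_union_singleton_iff] at hd
      have hTS : T = A \ S := Finset.eq_of_subset_of_card_le
        (Finset.subset_sdiff.2 ⟨hsub T hT, hd.1.symm⟩)
        (by rw [(Finset.mem_powersetCard.1 hSc).2, (Finset.mem_powersetCard.1 hT).2])
      subst hTS
      exact ⟨y, Finset.mem_erase.2 ⟨Ne.symm hd.2.2.2, hy⟩, rfl⟩
    · rintro ⟨y, hy, rfl⟩
      rw [Finset.mem_erase] at hy
      exact ⟨⟨_, hSc, y, hy.2, rfl⟩, disjoint_union_singleton_iff.2 ⟨Finset.disjoint_sdiff,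
        fun h => hfA S hS x hx (Finset.mem_sdiff.1 h).1,
        fun h => hfA _ hSc y hy.2 (hsub S hS h), Ne.symm hy.1⟩⟩
  rw [hset, Finset.card_image_of_injOn (union_singleton_injOn (hsub _ hSc)
    fun y hy => hfA _ hSc y (Finset.mem_of_mem_erase hy)),
    Finset.card_erase_of_mem ((hf S hS).2 ▸ hx), (Finset.mem_powersetCard.1 (hf _ hSc).1).2]
  rfl

/-! ### The main theorem -/

theorem theorem3p1 (k : ℕ) (hk : 2 < k) :
    ∃ R s₀ : ℕ, ∀ s : ℕ, s₀ < s → ∀ (V : Type*) [DecidableEq V],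
      (∀ F : Finset (Finset V), (F : Set (Finset V)).Sized k → IsAlmostIntersecting R s F →
        F.card ≤ (s + 1) * (2 * k - 2).choose (k - 1)) ∧
      (∀ F : Finset (Finset V),
        ((F : Set (Finset V)).Sized k ∧ IsAlmostIntersecting R s F ∧
          F.card = (s + 1) * (2 * k - 2).choose (k - 1)) ↔ IsDoubleStarFamily k s F) ∧
      (∀ F : Finset (Finset V), IsDoubleStarFamily k s F → IsAlmostIntersecting s s F) := by
  obtain ⟨N, hN⟩ : ∃ N, N = (2 * (k - 1)).choose (k - 1) := ⟨_, rfl⟩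
  obtain ⟨p, hp⟩ : ∃ p, p = k + 8 * N * k := ⟨_, rfl⟩
  obtain ⟨c, hc⟩ : ∃ c, c = 2 ^ ((2 * k).choose k * k) := ⟨_, rfl⟩
  -- `R` is just large enough to produce kernels. In `s₀`, the term `(p * k) ^ k` ensures `R ≤ s`,
  -- so that `M_f` is `[R,s]`-almost intersecting; the other two serve the counting.
  refine ⟨(p * k) ^ k + 1, (p * k) ^ k + 8 * c + 8 * k, fun s hs₀ V _ => ?_⟩
  rw [show 2 * k - 2 = 2 * (k - 1) by omega, ← hN]
  have key : ∀ F : Finset (Finset V), (F : Set (Finset V)).Sized k →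
      IsAlmostIntersecting ((p * k) ^ k + 1) s F → (s + 1) * N ≤ F.card →
      IsDoubleStarFamily k s F := by
    intro F hF hF' hcard
    have hs : ∀ A ∈ F, (F.filter (Disjoint A ·)).card ≤ s := fun A hA => by
      simpa only [Finset.disjoint_iff_inter_eq_empty] using (hF' A hA).2
    have hR : ∀ A ∈ F, (p * k) ^ k < (F.filter (Disjoint A ·)).card := fun A hA => by
      simp only [Finset.disjoint_iff_inter_eq_empty]
      exact (hF' A hA).1
    obtain ⟨W, hW, hfew, F₀, hF₀, hcov⟩ :=
      exists_ground_set hk hN hp hc (by omega) hF hs hR hcard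
    have hlarge := fun S hS => le_card_filter_inter_eq hk hN hcard hW hfew hF₀ hcov (S := S) hS
    refine isDoubleStarFamily_of_card_inter_eq hk hN hF hs hcard hW
      (fun A hA => card_inter_eq_of_le_card_filter hk (by omega) hF hs
        (fun A hA => (Nat.zero_le _).trans_lt (hR A hA)) hW hlarge hA) fun S hS => ?_
    rw [← Finset.card_pos]
    have := hlarge S hS
    omega
  have hcardeq : ∀ F : Finset (Finset V), IsDoubleStarFamily k s F → F.card = (s + 1) * N := by
    intro F h
    rw [h.card_eq, show 2 * k - 2 = 2 * (k - 1) by omega, hN]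
  refine ⟨fun F hF hF' => ?_, fun F => ⟨fun h => key F h.1 h.2.1 h.2.2.ge, fun h => ?_⟩,
    fun F h => h.isAlmostIntersecting⟩
  · by_contra hlt
    exact hlt (hcardeq F (key F hF hF' (by omega))).le
  · exact ⟨h.sized (by omega), fun A hA => ⟨le_trans (by omega) (h.isAlmostIntersecting A hA).1,
      (h.isAlmostIntersecting A hA).2⟩, hcardeq F h⟩
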